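/- Setting. Let $f\colon\mathbb R\to(-1,1)$ be a $C^2$ bijection with $f'>0$ such that $f''/f'$ has a finite positive limit at $-\infty$ and a finite negative limit at $+\infty$. Let $V\colon\mathbb R\to\mathbb R$ be of class $C^2$, with $V>0$ and $V'<0$ near $-\infty$, $V>0$ and $V'>0$ near $+\infty$, and such that $$u(s)=\frac{V'(f^{-1}(s))}{\sqrt6\,V(f^{-1}(s))}$$ has finite limits as $s\to-1^+$ and $s\to1^-$; denote them by $u(\pm1)$, and put $f'(f^{-1}(\pm1))=0$. Fix $\delta>0$ such that $V(f^{-1}(s))>0$ for $1-\delta\le|s|<1$ and $V'(f^{-1}(s))\neq0$ for $1-\delta<|s|<1$, and a smooth $\psi\colon[-1,1]\to[0,1]$ with $\psi=1$ for $|s|\le1-\delta$ and $\psi=0$ for $1-\delta/2<|s|\le1$. Let $$\theta_1=\sqrt{\tfrac32}\Big[w\big(1-w^2-\tfrac13z^2\big)-u(s)(1-w^2-z^2)\Big],\qquad \theta_2=\sqrt{\tfrac32}\,w\big(1-w^2-\tfrac13z^2\big)-\tfrac12V'(f^{-1}(s))x^2 ,$$ and consider, for $s\in[-1,1]$ and $x,w,z\in\mathbb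 R$, the system $$\frac{ds}{d\tau}=f'(f^{-1}(s))\,w,\quad \frac{dx}{d\tau}=-\frac{x}{\sqrt6}(3w^2+z^2),\quad \frac{dw}{d\tau}=(1-\psi(s))\theta_1+\psi(s)\theta_2,\quad \frac{dz}{d\tau}=\frac{z}{\sqrt6}(1-3w^2-z^2),$$ where a term with coefficient $\psi(s)=0$ or $1-\psi(s)=0$ is read as $0$. Let $\bar x>0$ and $$\Omega=\big\{(s,x,w,z)\in\mathbb R^4:\ s\in(-1,1),\ x\in(0,\bar x],\ V(f^{-1}(s))x^2+w^2+z^2=1\big\},$$ $$M_{-1}=\overline\Omega\cap\big(\{|s|=1\}\cup\{w^2+z^2=1\}\big)\cap\{x=0\}.$$ Theorem. (i) For every initial datum in $\Omega$ the system has a solution defined for all $\tau\ge0$; it is unique (every solution with the same datum on an interval $J\subseteq[0,\infty)$ containing $0$ is its restriction), and it remains in $\Omega$ for every $\tau\ge0$. (ii) $M_{-1}\subseteq\overline\Omega\setminus\Omega$. (iii) Generically, that is, for all initial data in some relatively open and dense subset of $\Omega$, the solution approaches $M_{-1}$, i.e. its distance from $M_{-1}$ tends to $0$ as $\tau\to\infty$;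 in particular, for these data, $\lim_{\tau\to\infty}x(\tau)=0^+$. -/

import Mathlib

open Set Filter Topology
open scoped ContDiff

noncomputable section

namespace ScalarCollapse

/-- The phase space: a point is `(s, x, w, z)`. -/
abbrev Phase : Type := ℝ × ℝ × ℝ × ℝ

/-- A `C²` change of variable `s = f φ`, carrying `ℝ` onto `(-1, 1)` with positive derivative,
such that `f'' / f'` has a positive limit at `-∞` and a negative limit at `+∞`. -/
structure IsCompactifier (f : ℝ → ℝ) : Prop where
  contDiff : ContDiff ℝ 2 f
  strictMono : StrictMono f
  deriv_pos : ∀ φ, 0 < deriv f φ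
  range_eq : range f = Ioo (-1) 1
  limit_atBot : ∃ l : ℝ, 0 < l ∧ Tendsto (fun φ => deriv (deriv f) φ / deriv f φ) atBot (𝓝 l)
  limit_atTop : ∃ l : ℝ, l < 0 ∧ Tendsto (fun φ => deriv (deriv f) φ / deriv f φ) atTop (𝓝 l)

/-- The inverse `f⁻¹ : (-1, 1) → ℝ` (only its values on `(-1, 1)` are meaningful). -/
def finv (f : ℝ → ℝ) (s : ℝ) : ℝ := Function.invFun f s

/-- The function `u(s) = V'(f⁻¹ s) / (√6 V(f⁻¹ s))` on `(-1, 1)`. -/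
def uFun (V f : ℝ → ℝ) (s : ℝ) : ℝ :=
  deriv V (finv f s) / (Real.sqrt 6 * V (finv f s))

/-- The extension of `u` to `[-1, 1]` by its one-sided limits at the two ends. -/
def uExt (V f : ℝ → ℝ) (s : ℝ) : ℝ :=
  if s = 1 then limUnder (𝓝[<] (1 : ℝ)) (uFun V f)
  else if s = -1 then limUnder (𝓝[>] (-1 : ℝ)) (uFun V f)
  else uFun V f s

/-- The extension of `s ↦ f'(f⁻¹ s)` to `[-1, 1]` by the value `0` at the two ends. -/
def speed (f : ℝ → ℝ) (s : ℝ) : ℝ :=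
  if s ∈ Ioo (-1 : ℝ) 1 then deriv f (finv f s) else 0

/-- The assumption on the potential `V`, relative to the compactification `f`. -/
structure IsAdmissiblePotential (V f : ℝ → ℝ) : Prop where
  contDiff : ContDiff ℝ 2 V
  eventually_atBot : ∀ᶠ φ in atBot, 0 < V φ ∧ deriv V φ < 0
  eventually_atTop : ∀ᶠ φ in atTop, 0 < V φ ∧ 0 < deriv V φ
  limit_left : ∃ l : ℝ, Tendsto (uFun V f) (𝓝[>] (-1 : ℝ)) (𝓝 l)
  limit_right : ∃ l : ℝ, Tendsto (uFun V f) (𝓝[<] (1 : ℝ)) (𝓝 l)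

/-- `δ > 0` such that `V > 0` and `V' ≠ 0` near the two ends, and a smooth cutoff
`ψ : [-1, 1] → [0, 1]` equal to `1` for `|s| ≤ 1 - δ` and to `0` for `|s| > 1 - δ / 2`. -/
structure IsCutoff (V f : ℝ → ℝ) (δ : ℝ) (ψ : ℝ → ℝ) : Prop where
  delta_pos : 0 < δ
  potential_pos : ∀ s : ℝ, 1 - δ ≤ |s| → |s| < 1 → 0 < V (finv f s)
  deriv_ne_zero : ∀ s : ℝ, 1 - δ < |s| → |s| < 1 → deriv V (finv f s) ≠ 0
  contDiffOn : ContDiffOn ℝ ∞ ψ (Icc (-1) 1)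
  mem_Icc : ∀ s ∈ Icc (-1 : ℝ) 1, ψ s ∈ Icc (0 : ℝ) 1
  eq_one : ∀ s : ℝ, |s| ≤ 1 - δ → s ∈ Icc (-1 : ℝ) 1 → ψ s = 1
  eq_zero : ∀ s : ℝ, 1 - δ / 2 < |s| → s ∈ Icc (-1 : ℝ) 1 → ψ s = 0

/-- The right-hand side of the equation for `w` in terms of `u`. -/
def theta1 (V f : ℝ → ℝ) (s w z : ℝ) : ℝ :=
  Real.sqrt (3 / 2) * (w * (1 - w ^ 2 - z ^ 2 / 3) - uExt V f s * (1 - w ^ 2 - z ^ 2))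

/-- The right-hand side of the equation for `w` in terms of `V'`. -/
def theta2 (V f : ℝ → ℝ) (s x w z : ℝ) : ℝ :=
  Real.sqrt (3 / 2) * w * (1 - w ^ 2 - z ^ 2 / 3) - 1 / 2 * deriv V (finv f s) * x ^ 2

/-- The vector field of the system in the variables `(s, x, w, z)`, for `κ = -1`. Where `V`
may vanish `1 - ψ = 0`, and at `s = ±1`, where `f⁻¹` is undefined, `ψ = 0`. -/
def field (V f ψ : ℝ → ℝ) : Phase → Phase
  | (s, x, w, z) =>
    (speed f s * w,
      -(x / Real.sqrt 6) * (3 * w ^ 2 + z ^ 2),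
      (1 - ψ s) * theta1 V f s w z + ψ s * theta2 V f s x w z,
      z / Real.sqrt 6 * (1 - 3 * w ^ 2 - z ^ 2))

/-- `γ` solves the system on the time interval `J`, in the phase space `s ∈ [-1, 1]`. -/
def IsSolutionOn (V f ψ : ℝ → ℝ) (J : Set ℝ) (γ : ℝ → Phase) : Prop :=
  ∀ τ ∈ J, (γ τ).1 ∈ Icc (-1 : ℝ) 1 ∧ HasDerivWithinAt γ (field V f ψ (γ τ)) J τ

/-- The set `Ω`: the constraint set with `s ∈ (-1, 1)` and `x ∈ (0, xbar]`. -/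
def omegaSet (V f : ℝ → ℝ) (xbar : ℝ) : Set Phase :=
  {p | match p with
    | (s, x, w, z) =>
      s ∈ Ioo (-1 : ℝ) 1 ∧ x ∈ Ioc 0 xbar ∧ V (finv f s) * x ^ 2 + w ^ 2 + z ^ 2 = 1}

/-- The set `M₋₁ = closure Ω ∩ ({|s| = 1} ∪ {w² + z² = 1}) ∩ {x = 0}`. -/
def limitSet (V f : ℝ → ℝ) (xbar : ℝ) : Set Phase :=
  closure (omegaSet V f xbar) ∩
    ({p | |p.1| = 1} ∪ {p | p.2.2.1 ^ 2 + p.2.2.2 ^ 2 = 1}) ∩ {p | p.2.1 = 0}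

/-- `γ` approaches the set `M`: the distance of `γ τ` from `M` tends to zero as `τ → ∞`. -/
def Approaches (γ : ℝ → Phase) (M : Set Phase) : Prop :=
  Tendsto (fun τ => Metric.infEDist (γ τ) M) atTop (𝓝 0)

/-- `P` holds for generic points of `A`: it holds at all points of a relatively open dense
subset of `A`. -/
def HoldsGenericallyOn (A : Set Phase) (P : Phase → Prop) : Prop :=
  ∃ U : Set Phase, IsOpen U ∧ A ⊆ closure (U ∩ A) ∧ ∀ p ∈ U ∩ A, P p

end ScalarCollapse

end

/-! On the constraint set `1 - w² - z² = V x²`, so `θ₁` and `θ₂` agree wherever `V > 0` and the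
cutoff becomes invisible. In the variable `φ = f⁻¹ s` the system is then the `C¹` field `fieldPhi`,
free of quotients (`field_liftPhi`). There the constraint is preserved and `|x|` does not increase;
since `V` is bounded below, `w² + z²` stays bounded and `φ` grows at most linearly. Hence solutions
are global, and `s = f φ` never reaches `±1`.

Genericity comes from one identity: the logarithmic derivatives of `z` and `x` differ by exactly
`1/√6`, so `z/x` is a constant times `exp (τ/√6)` (`z_mul_exp_div_x`). As `z` is bounded, `z ≠ 0` at
the start forces `x → 0`. The condition `z ≠ 0` is open, and dense in `Ω`. Finally `closure Ω` is
compact and its points with `x = 0` all lie in `M₋₁`, so `x → 0` implies convergence to `M₋₁`. -/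

noncomputable section

namespace ScalarCollapse

/-! ### Uniqueness and global existence for autonomous equations. -/

section GeneralODE

variable {E : Type*} [NormedAddCommGroup E] [NormedSpace ℝ E]

/-- A derivative within a closed interval is a right derivative, except at the right end. -/
theorem hasDerivWithinAt_Ici_of_Icc {γ : ℝ → E} {v : E} {T t : ℝ} (ht : t ∈ Ico 0 T)
    (h : HasDerivWithinAt γ v (Icc 0 T) t) : HasDerivWithinAt γ v (Ici t) t := by
  refine h.mono_of_mem_nhdsWithin ?_
  exact mem_of_superset (Icc_mem_nhdsGE ht.2) (Icc_subset_Icc_left ht.1)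

/-- Two solutions on `[0, T]` of an autonomous equation with the same initial value coincide, if
the vector field is Lipschitz near each point of the first solution. -/
theorem eqOn_Icc_of_locally_lipschitz {F : E → E} {γ η : ℝ → E} {T : ℝ}
    (hF : ∀ t ∈ Icc 0 T, ∃ K, ∃ U ∈ 𝓝 (γ t), LipschitzOnWith K F U)
    (hγ : ∀ t ∈ Icc 0 T, HasDerivWithinAt γ (F (γ t)) (Icc 0 T) t)
    (hη : ∀ t ∈ Icc 0 T, HasDerivWithinAt η (F (η t)) (Icc 0 T) t)
    (h0 : γ 0 = η 0) : EqOn γ η (Icc 0 T) := by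
  have cγ : ContinuousOn γ (Icc 0 T) := fun t ht => (hγ t ht).continuousWithinAt
  have cη : ContinuousOn η (Icc 0 T) := fun t ht => (hη t ht).continuousWithinAt
  have hcl : IsClosed ({t | γ t = η t} ∩ Icc 0 T) := by
    rw [inter_comm]
    have : Icc 0 T ∩ {t | γ t = η t} = Icc 0 T ∩ (fun t => γ t - η t) ⁻¹' {0} := by
      ext t; simp [sub_eq_zero]
    rw [this]
    exact (cγ.sub cη).preimage_isClosed_of_isClosed isClosed_Icc isClosed_singleton
  refine hcl.Icc_subset_of_forall_mem_nhdsWithin h0 ?_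
  rintro t ⟨hte, ht⟩
  obtain ⟨K, U, hU, hK⟩ := hF t (Ico_subset_Icc_self ht)
  -- The Lipschitz neighbourhood belongs to `γ t`; as both curves pass through that point,
  -- continuity keeps both inside it for a short time.
  have near : ∀ ζ : ℝ → E, (∀ r ∈ Icc 0 T, HasDerivWithinAt ζ (F (ζ r)) (Icc 0 T) r) →
      ζ t = γ t → ∀ᶠ r in 𝓝[≥] t, ζ r ∈ U := by
    intro ζ hζ e
    have := (hasDerivWithinAt_Ici_of_Icc ht (hζ t (Ico_subset_Icc_self ht))).continuousWithinAt
    exact this.eventually_mem (e ▸ hU)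
  obtain ⟨b, hb, hbs⟩ := (mem_nhdsGE_iff_exists_Icc_subset).1
    (((near γ hγ rfl).and (near η hη hte.symm)).and (Icc_mem_nhdsGE ht.2))
  have hbT : b ≤ T := (hbs (right_mem_Icc.2 (le_of_lt hb))).2.2
  have hsub : Icc t b ⊆ Icc 0 T := Icc_subset_Icc ht.1 hbT
  have key : EqOn γ η (Icc t b) := by
    refine ODE_solution_unique_of_mem_Icc_right (v := fun _ => F) (s := fun _ => U) (K := K)
      (fun _ _ => hK) (cγ.mono hsub) ?_ ?_ (cη.mono hsub) ?_ ?_ hte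
    · exact fun r hr => hasDerivWithinAt_Ici_of_Icc ⟨ht.1.trans hr.1, hr.2.trans_le hbT⟩
        (hγ r (hsub (Ico_subset_Icc_self hr)))
    · exact fun r hr => (hbs (Ico_subset_Icc_self hr)).1.1
    · exact fun r hr => hasDerivWithinAt_Ici_of_Icc ⟨ht.1.trans hr.1, hr.2.trans_le hbT⟩
        (hη r (hsub (Ico_subset_Icc_self hr)))
    · exact fun r hr => (hbs (Ico_subset_Icc_self hr)).1.2
  exact mem_of_superset (Icc_mem_nhdsGT hb) key

/-- A bounded, globally Lipschitz autonomous vector field has solutions on `[0, T]`. -/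
theorem exists_solution_Icc_of_bounded_lipschitz [CompleteSpace E] {F : E → E} {K L : NNReal}
    (hK : LipschitzWith K F) (hL : ∀ y, ‖F y‖ ≤ L) (p : E) {T : ℝ} (hT : 0 ≤ T) :
    ∃ γ : ℝ → E, γ 0 = p ∧ ∀ t ∈ Icc 0 T, HasDerivWithinAt γ (F (γ t)) (Icc 0 T) t := by
  -- A ball of radius `L * T` around a single initial point turns the Picard–Lindelöf smallness
  -- condition into an equality, so `T` need not be small.
  have h : IsPicardLindelof (fun _ => F) (tmin := 0) (tmax := T) ⟨0, left_mem_Icc.2 hT⟩ p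
      (L * ⟨T, hT⟩) 0 L K :=
    { lipschitzOnWith := fun _ _ => hK.lipschitzOnWith
      continuousOn := fun _ _ => continuousOn_const
      norm_le := fun _ _ y _ => hL y
      mul_max_le := by
        simp only [sub_zero, sub_self, max_eq_left hT, NNReal.coe_zero]
        exact le_rfl }
  exact h.exists_eq_forall_mem_Icc_hasDerivWithinAt₀

/-- A `C¹` vector field has a solution on `[0, T]` if all solutions on shorter intervals obey a
common bound. -/
theorem exists_solution_Icc_of_apriori_bound [FiniteDimensional ℝ E] {F : E → E}
    (hF : ContDiff ℝ 1 F) (p : E) {T R : ℝ} (hT : 0 ≤ T)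
    (hR : ∀ t ∈ Icc 0 T, ∀ γ : ℝ → E, γ 0 = p →
      (∀ r ∈ Icc 0 t, HasDerivWithinAt γ (F (γ r)) (Icc 0 t) r) → ‖γ t‖ ≤ R) :
    ∃ γ : ℝ → E, γ 0 = p ∧ ∀ t ∈ Icc 0 T, HasDerivWithinAt γ (F (γ t)) (Icc 0 T) t := by
  have : CompleteSpace E := FiniteDimensional.complete ℝ E
  have hR0 : ‖p‖ ≤ R := by
    refine hR 0 (left_mem_Icc.2 hT) (fun _ => p) rfl fun r _ => ?_
    rw [Icc_self]
    exact HasFDerivWithinAt.of_subsingleton subsingleton_singleton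
  have hR1 : 0 ≤ R := (norm_nonneg p).trans hR0
  -- Truncating at `R + 1` instead of `R` leaves the room needed for the bootstrap below.
  let χ : ContDiffBump (0 : E) := ⟨R + 1, R + 2, by linarith, by linarith⟩
  have hcd : ContDiff ℝ 1 fun y => χ y • F y := (χ.contDiff).smul hF
  have hcs : HasCompactSupport fun y => χ y • F y := χ.hasCompactSupport.smul_right
  obtain ⟨K, hK⟩ := ContDiff.lipschitzWith_of_hasCompactSupport hcs hcd one_ne_zero
  obtain ⟨L, hL⟩ := hcs.exists_bound_of_continuous hcd.continuous
  obtain ⟨γ, h0, hγ⟩ := exists_solution_Icc_of_bounded_lipschitz hK (L := L.toNNReal)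
    (fun y => (hL y).trans (Real.le_coe_toNNReal L)) p hT
  have hone : ∀ y, ‖y‖ ≤ R + 1 → χ y • F y = F y := fun y hy => by
    rw [χ.one_of_mem_closedBall (by simpa using hy), one_smul]
  have cγ : ContinuousOn γ (Icc 0 T) := fun t ht => (hγ t ht).continuousWithinAt
  -- While the norm is at most `R + 1` the curve solves the original equation, so it obeys the bound
  -- `R`; by continuity it cannot cross `R + 1`.
  have hin : Icc 0 T ⊆ {t | ‖γ t‖ ≤ R + 1} := by
    refine IsClosed.Icc_subset_of_forall_mem_nhdsGT_of_Icc_subset ?_ ?_ ?_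
    · rw [inter_comm]
      exact cγ.norm.preimage_isClosed_of_isClosed isClosed_Icc isClosed_Iic
    · simp only [mem_ofPred_eq, h0]; linarith
    · intro t ht hsub
      have hb : ‖γ t‖ ≤ R := by
        refine hR t (Ico_subset_Icc_self ht) γ h0 fun r hr => ?_
        have := hγ r ⟨hr.1, hr.2.trans ht.2.le⟩
        rw [hone _ (hsub hr)] at this
        exact this.mono (Icc_subset_Icc_right ht.2.le)
      have hc := (hasDerivWithinAt_Ici_of_Icc ht
        (hγ t (Ico_subset_Icc_self ht))).continuousWithinAt.norm
      have : ∀ᶠ r in 𝓝[≥] t, ‖γ r‖ < R + 1 := hc.eventually_lt_const (by linarith)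
      exact mem_of_superset (nhdsWithin_mono t Ioi_subset_Ici_self this) fun r (hr : ‖γ r‖ < R + 1) => hr.le
  refine ⟨γ, h0, fun t ht => ?_⟩
  have := hγ t ht
  rwa [hone _ (hin ht)] at this

/-- A `C¹` vector field has a solution on `[0, ∞)` if solutions on bounded intervals are
bounded a priori. -/
theorem exists_solution_Ici_of_apriori_bound [FiniteDimensional ℝ E] {F : E → E}
    (hF : ContDiff ℝ 1 F) (p : E) (R : ℝ → ℝ)
    (hR : ∀ T, ∀ t ∈ Icc 0 T, ∀ γ : ℝ → E, γ 0 = p →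
      (∀ r ∈ Icc 0 t, HasDerivWithinAt γ (F (γ r)) (Icc 0 t) r) → ‖γ t‖ ≤ R T) :
    ∃ γ : ℝ → E, γ 0 = p ∧ ∀ t ∈ Ici 0, HasDerivWithinAt γ (F (γ t)) (Ici 0) t := by
  choose γ h0 hγ using fun n : ℕ =>
    exists_solution_Icc_of_apriori_bound hF p (Nat.cast_nonneg n) (hR n)
  have hloc : ∀ y, ∃ K, ∃ U ∈ 𝓝 y, LipschitzOnWith K F U := fun y =>
    hF.contDiffAt.exists_lipschitzOnWith
  have heq : ∀ (m n : ℕ) (t : ℝ), 0 ≤ t → t ≤ m → t ≤ n → γ m t = γ n t := by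
    intro m n t ht hm hn
    refine eqOn_Icc_of_locally_lipschitz (T := t) (fun r _ => hloc _) ?_ ?_
      ((h0 m).trans (h0 n).symm) (right_mem_Icc.2 ht)
    · exact fun r hr => (hγ m r ⟨hr.1, hr.2.trans hm⟩).mono (Icc_subset_Icc_right hm)
    · exact fun r hr => (hγ n r ⟨hr.1, hr.2.trans hn⟩).mono (Icc_subset_Icc_right hn)
  -- The `+ 1` puts `t` strictly before the right end of the interval, so a derivative within it is
  -- one within `[0, ∞)`.
  refine ⟨fun t => γ (⌈t⌉₊ + 1) t, h0 _, fun t ht => ?_⟩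
  have hle : ∀ r : ℝ, r < (⌈r⌉₊ + 1 : ℕ) := fun r => by
    push_cast
    linarith [Nat.le_ceil r]
  have hd := hγ (⌈t⌉₊ + 1) t ⟨ht, (hle t).le⟩
  have hd' : HasDerivWithinAt (γ (⌈t⌉₊ + 1)) (F (γ (⌈t⌉₊ + 1) t)) (Ici 0) t := by
    refine hd.mono_of_mem_nhdsWithin ?_
    rw [← Ici_inter_Iic]
    exact inter_mem_nhdsWithin _ (Iic_mem_nhds (hle t))
  refine hd'.congr_of_eventuallyEq ?_ rfl
  filter_upwards [inter_mem_nhdsWithin (Ici (0 : ℝ)) (Iic_mem_nhds (hle t))] with r hr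
  exact heq _ _ r hr.1 (hle r).le hr.2

end GeneralODE

/-! ### The system in the uncompactified variable `φ`. -/

/-- Componentwise description of derivatives of curves in the phase space. -/
theorem hasDerivWithinAt_phase_iff {γ : ℝ → Phase} {v : Phase} {J : Set ℝ} {t : ℝ} :
    HasDerivWithinAt γ v J t ↔
      HasDerivWithinAt (fun r => (γ r).1) v.1 J t ∧
      HasDerivWithinAt (fun r => (γ r).2.1) v.2.1 J t ∧
      HasDerivWithinAt (fun r => (γ r).2.2.1) v.2.2.1 J t ∧
      HasDerivWithinAt (fun r => (γ r).2.2.2) v.2.2.2 J t := by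
  constructor
  · intro h
    have h2 := h.snd
    have h3 := h2.snd
    exact ⟨h.fst, h2.fst, h3.fst, h3.snd⟩
  · rintro ⟨h1, h2, h3, h4⟩
    exact h1.prodMk (h2.prodMk (h3.prodMk h4))

/-- The system on the constraint set, with the original variable `φ` in place of `s = f φ`. -/
def fieldPhi (V : ℝ → ℝ) (q : Phase) : Phase :=
  (q.2.2.1,
    -(q.2.1 / Real.sqrt 6) * (3 * q.2.2.1 ^ 2 + q.2.2.2 ^ 2),
    Real.sqrt (3 / 2) * q.2.2.1 * (1 - q.2.2.1 ^ 2 - q.2.2.2 ^ 2 / 3)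
      - 1 / 2 * deriv V q.1 * q.2.1 ^ 2,
    q.2.2.2 / Real.sqrt 6 * (1 - 3 * q.2.2.1 ^ 2 - q.2.2.2 ^ 2))

/-- The constraint function in the variables `(φ, x, w, z)`. -/
def constraint (V : ℝ → ℝ) (q : Phase) : ℝ :=
  V q.1 * q.2.1 ^ 2 + q.2.2.1 ^ 2 + q.2.2.2 ^ 2

theorem contDiff_deriv {V : ℝ → ℝ} (hV : ContDiff ℝ 2 V) : ContDiff ℝ 1 (deriv V) :=
  (contDiff_succ_iff_deriv (n := 1)).1 hV |>.2.2

theorem contDiff_fieldPhi {V : ℝ → ℝ} (hV : ContDiff ℝ 2 V) : ContDiff ℝ 1 (fieldPhi V) := by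
  have h := contDiff_deriv hV
  unfold fieldPhi
  fun_prop

theorem sqrt_three_halves : Real.sqrt (3 / 2) = 3 / Real.sqrt 6 := by
  have h6 : (0 : ℝ) < Real.sqrt 6 := by positivity
  rw [eq_div_iff h6.ne', ← Real.sqrt_mul (by norm_num), show (3 / 2 * 6 : ℝ) = 3 ^ 2 by norm_num]
  exact Real.sqrt_sq (by norm_num)

theorem monotoneOn_Icc_of_hasDerivWithinAt {g g' : ℝ → ℝ} {T : ℝ}
    (h : ∀ t ∈ Icc 0 T, HasDerivWithinAt g (g' t) (Icc 0 T) t)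
    (h0 : ∀ t ∈ Icc 0 T, 0 ≤ g' t) : MonotoneOn g (Icc 0 T) :=
  monotoneOn_of_hasDerivWithinAt_nonneg (convex_Icc 0 T)
    (fun t ht => (h t ht).continuousWithinAt)
    (fun t ht => (h t (interior_subset ht)).mono interior_subset)
    fun t ht => h0 t (interior_subset ht)

theorem antitoneOn_Icc_of_hasDerivWithinAt {g g' : ℝ → ℝ} {T : ℝ}
    (h : ∀ t ∈ Icc 0 T, HasDerivWithinAt g (g' t) (Icc 0 T) t)
    (h0 : ∀ t ∈ Icc 0 T, g' t ≤ 0) : AntitoneOn g (Icc 0 T) := by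
  have := monotoneOn_Icc_of_hasDerivWithinAt (fun t ht => (h t ht).neg)
    (fun t ht => neg_nonneg.2 (h0 t ht))
  exact fun a ha b hb hab => neg_le_neg_iff.1 (this ha hb hab)

/-- A potential which is positive near both ends is bounded below. -/
theorem exists_lower_bound {V f : ℝ → ℝ} (hV : IsAdmissiblePotential V f) :
    ∃ C : ℝ, 0 ≤ C ∧ ∀ φ, -C ≤ V φ := by
  obtain ⟨a, ha⟩ := eventually_atBot.1 hV.eventually_atBot
  obtain ⟨b, hb⟩ := eventually_atTop.1 hV.eventually_atTop
  obtain ⟨m, hm⟩ := (isCompact_Icc (a := a) (b := b)).bddBelow_image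
    hV.contDiff.continuous.continuousOn
  refine ⟨max 0 (-m), le_max_left _ _, fun φ => ?_⟩
  rcases le_total φ a with h | h
  · linarith [(ha φ h).1, le_max_left 0 (-m)]
  rcases le_total b φ with h' | h'
  · linarith [(hb φ h').1, le_max_left 0 (-m)]
  · linarith [hm (mem_image_of_mem V ⟨h, h'⟩), le_max_right 0 (-m)]

/-! ### Conserved quantities and a priori bounds. -/

section Invariants

variable {V : ℝ → ℝ} {γ : ℝ → Phase} {T : ℝ}

/-- The constraint is preserved. -/
theorem constraint_eq_one (hV : Differentiable ℝ V)
    (hγ : ∀ t ∈ Icc 0 T, HasDerivWithinAt γ (fieldPhi V (γ t)) (Icc 0 T) t)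
    (h0 : constraint V (γ 0) = 1) {t : ℝ} (ht : t ∈ Icc 0 T) : constraint V (γ t) = 1 := by
  have h6 : (0 : ℝ) < Real.sqrt 6 := by positivity
  -- The defect `1 - constraint` solves a linear homogeneous equation with coefficient `≤ 0`; its
  -- square is nonincreasing and starts at `0`.
  have hd : ∀ t ∈ Icc 0 T, HasDerivWithinAt (fun r => (1 - constraint V (γ r)) ^ 2)
      (-(4 / Real.sqrt 6) * (3 * (γ t).2.2.1 ^ 2 + (γ t).2.2.2 ^ 2)
        * (1 - constraint V (γ t)) ^ 2) (Icc 0 T) t := by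
    intro t ht
    obtain ⟨h1, h2, h3, h4⟩ := hasDerivWithinAt_phase_iff.1 (hγ t ht)
    have hVd := (hV (γ t).1).hasDerivAt.comp_hasDerivWithinAt t h1
    have := ((((hVd.mul (h2.pow 2)).add (h3.pow 2)).add (h4.pow 2)).const_sub 1).pow 2
    refine this.congr_deriv ?_
    simp only [fieldPhi, constraint, sqrt_three_halves, Function.comp, Pi.add_apply, Pi.mul_apply,
      Pi.pow_apply]
    field_simp
    ring
  have hm := antitoneOn_Icc_of_hasDerivWithinAt hd fun t _ => by
    have : 0 ≤ 4 / Real.sqrt 6 * (3 * (γ t).2.2.1 ^ 2 + (γ t).2.2.2 ^ 2)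
        * (1 - constraint V (γ t)) ^ 2 := by positivity
    linarith
  have := hm (left_mem_Icc.2 (ht.1.trans ht.2)) ht ht.1
  simp only [h0, sub_self] at this
  nlinarith

/-- `|x|` does not increase. -/
theorem abs_x_le (hγ : ∀ t ∈ Icc 0 T, HasDerivWithinAt γ (fieldPhi V (γ t)) (Icc 0 T) t)
    {t : ℝ} (ht : t ∈ Icc 0 T) : |(γ t).2.1| ≤ |(γ 0).2.1| := by
  have h6 : (0 : ℝ) < Real.sqrt 6 := by positivity
  have hd : ∀ t ∈ Icc 0 T, HasDerivWithinAt (fun r => (γ r).2.1 ^ 2)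
      (-(2 / Real.sqrt 6) * (3 * (γ t).2.2.1 ^ 2 + (γ t).2.2.2 ^ 2) * (γ t).2.1 ^ 2)
      (Icc 0 T) t := by
    intro t ht
    obtain ⟨-, h2, -, -⟩ := hasDerivWithinAt_phase_iff.1 (hγ t ht)
    refine (h2.pow 2).congr_deriv ?_
    simp only [fieldPhi]
    field_simp
    ring
  have hm := antitoneOn_Icc_of_hasDerivWithinAt hd fun t _ => by
    have : 0 ≤ 2 / Real.sqrt 6 * (3 * (γ t).2.2.1 ^ 2 + (γ t).2.2.2 ^ 2) * (γ t).2.1 ^ 2 := by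
      positivity
    linarith
  exact sq_le_sq.1 (hm (left_mem_Icc.2 (ht.1.trans ht.2)) ht ht.1)

/-- On the constraint set `w² + z²` is bounded. -/
theorem sq_add_sq_le {C : ℝ} (hC : 0 ≤ C) (hVC : ∀ φ, -C ≤ V φ) {q : Phase}
    (hq : constraint V q = 1) {X : ℝ} (hX : |q.2.1| ≤ X) :
    q.2.2.1 ^ 2 + q.2.2.2 ^ 2 ≤ 1 + C * X ^ 2 := by
  have h1 : q.2.1 ^ 2 ≤ X ^ 2 := by
    rw [← sq_abs]
    exact pow_le_pow_left₀ (abs_nonneg _) hX 2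
  have h2 : -C * q.2.1 ^ 2 ≤ V q.1 * q.2.1 ^ 2 :=
    mul_le_mul_of_nonneg_right (hVC _) (sq_nonneg _)
  have h3 := mul_le_mul_of_nonneg_left h1 hC
  unfold constraint at hq
  linarith

/-- `x` stays positive as long as `w² + z²` is bounded. -/
theorem x_pos {B : ℝ} (hγ : ∀ t ∈ Icc 0 T, HasDerivWithinAt γ (fieldPhi V (γ t)) (Icc 0 T) t)
    (hB : ∀ t ∈ Icc 0 T, (γ t).2.2.1 ^ 2 + (γ t).2.2.2 ^ 2 ≤ B)
    (h0 : 0 < (γ 0).2.1) {t : ℝ} (ht : t ∈ Icc 0 T) : 0 < (γ t).2.1 := by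
  have h6 : (0 : ℝ) < Real.sqrt 6 := by positivity
  -- Since `3 w² + z² ≤ 3 B`, the decay rate of `|x|` is at most `k`; thus `x² exp (2 k τ)` is
  -- nondecreasing and `x` has no zero.
  set k : ℝ := 3 * B / Real.sqrt 6
  have hd : ∀ t ∈ Icc 0 T, HasDerivWithinAt (fun r => (γ r).2.1 ^ 2 * Real.exp (2 * k * r))
      (2 / Real.sqrt 6 * (3 * B - (3 * (γ t).2.2.1 ^ 2 + (γ t).2.2.2 ^ 2)) * (γ t).2.1 ^ 2
        * Real.exp (2 * k * t)) (Icc 0 T) t := by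
    intro t ht
    obtain ⟨-, h2, -, -⟩ := hasDerivWithinAt_phase_iff.1 (hγ t ht)
    have he : HasDerivAt (fun r => Real.exp (2 * k * r)) (Real.exp (2 * k * t) * (2 * k)) t := by
      simpa using ((hasDerivAt_id t).const_mul (2 * k)).exp
    refine ((h2.pow 2).mul he.hasDerivWithinAt).congr_deriv ?_
    simp only [fieldPhi, k, Pi.pow_apply]
    field_simp
    ring
  have hm := monotoneOn_Icc_of_hasDerivWithinAt hd fun t ht => by
    have : 0 ≤ 3 * B - (3 * (γ t).2.2.1 ^ 2 + (γ t).2.2.2 ^ 2) := by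
      nlinarith [hB t ht, sq_nonneg (γ t).2.2.2]
    positivity
  have hne : ∀ r ∈ Icc 0 T, (γ r).2.1 ≠ 0 := by
    intro r hr e
    have := hm (left_mem_Icc.2 (hr.1.trans hr.2)) hr hr.1
    simp only [e, mul_zero, Real.exp_zero, mul_one] at this
    nlinarith [sq_pos_of_pos h0]
  by_contra hneg
  have hc : ContinuousOn (fun r => (γ r).2.1) (Icc 0 t) := fun r hr =>
    ((hasDerivWithinAt_phase_iff.1 (hγ r ⟨hr.1, hr.2.trans ht.2⟩)).2.1.mono
      (Icc_subset_Icc_right ht.2)).continuousWithinAt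
  obtain ⟨r, hr, hr0⟩ := intermediate_value_Icc' ht.1 hc ⟨not_lt.1 hneg, h0.le⟩
  exact hne r ⟨hr.1, hr.2.trans ht.2⟩ hr0

/-- The ratio `z / x` grows exactly like `exp (τ / √6)`. -/
theorem z_mul_exp_div_x (hγ : ∀ t ∈ Icc 0 T, HasDerivWithinAt γ (fieldPhi V (γ t)) (Icc 0 T) t)
    (hx : ∀ t ∈ Icc 0 T, 0 < (γ t).2.1) {t : ℝ} (ht : t ∈ Icc 0 T) :
    (γ t).2.2.2 * Real.exp (-t / Real.sqrt 6) / (γ t).2.1 = (γ 0).2.2.2 / (γ 0).2.1 := by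
  have h6 : (0 : ℝ) < Real.sqrt 6 := by positivity
  have hd : ∀ t ∈ Icc 0 T, HasDerivWithinAt
      (fun r => (γ r).2.2.2 * Real.exp (-r / Real.sqrt 6) / (γ r).2.1) 0 (Icc 0 T) t := by
    intro t ht
    obtain ⟨-, h2, -, h4⟩ := hasDerivWithinAt_phase_iff.1 (hγ t ht)
    have he : HasDerivAt (fun r => Real.exp (-r / Real.sqrt 6))
        (Real.exp (-t / Real.sqrt 6) * (-1 / Real.sqrt 6)) t :=
      ((hasDerivAt_neg t).div_const (Real.sqrt 6)).exp
    have hxt := hx t ht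
    refine ((h4.mul he.hasDerivWithinAt).div h2 hxt.ne').congr_deriv ?_
    simp only [fieldPhi, Pi.mul_apply]
    field_simp
    ring
  have := constant_of_has_deriv_right_zero (fun r hr => (hd r hr).continuousWithinAt)
    (fun r hr => hasDerivWithinAt_Ici_of_Icc hr (hd r (Ico_subset_Icc_self hr))) t ht
  simpa using this

/-- `φ` grows at most linearly. -/
theorem abs_phi_le {B : ℝ} (hB1 : 1 ≤ B)
    (hγ : ∀ t ∈ Icc 0 T, HasDerivWithinAt γ (fieldPhi V (γ t)) (Icc 0 T) t)
    (hB : ∀ t ∈ Icc 0 T, (γ t).2.2.1 ^ 2 + (γ t).2.2.2 ^ 2 ≤ B) {t : ℝ} (ht : t ∈ Icc 0 T) :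
    |(γ t).1| ≤ |(γ 0).1| + B * T := by
  have hT := ht.1.trans ht.2
  have := (convex_Icc 0 T).norm_image_sub_le_of_norm_hasDerivWithin_le (C := B)
    (fun r hr => (hasDerivWithinAt_phase_iff.1 (hγ r hr)).1)
    (fun r hr => by
      simp only [fieldPhi, Real.norm_eq_abs]
      -- Here `1 ≤ B` gives `w² ≤ B ≤ B²`, which avoids the square root of `B`.
      refine abs_le_of_sq_le_sq ?_ (by linarith)
      nlinarith [hB r hr, sq_nonneg (γ r).2.2.2]) (left_mem_Icc.2 hT) ht
  simp only [Real.norm_eq_abs, sub_zero, abs_of_nonneg ht.1] at this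
  have h2 : B * t ≤ B * T := mul_le_mul_of_nonneg_left ht.2 (by linarith)
  have h3 := abs_sub_abs_le_abs_sub (γ t).1 (γ 0).1
  linarith

end Invariants

/-- Data on the constraint set with `x > 0` have global solutions in the variables
`(φ, x, w, z)`. -/
theorem exists_global_solution_fieldPhi {V f : ℝ → ℝ} (hV : IsAdmissiblePotential V f) (q : Phase)
    (hq : constraint V q = 1) :
    ∃ γ : ℝ → Phase, γ 0 = q ∧ ∀ t ∈ Ici 0, HasDerivWithinAt γ (fieldPhi V (γ t)) (Ici 0) t := by
  obtain ⟨C, hC, hVC⟩ := exists_lower_bound hV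
  set B : ℝ := 1 + C * |q.2.1| ^ 2
  have hB1 : 1 ≤ B := by
    have : 0 ≤ C * |q.2.1| ^ 2 := by positivity
    linarith
  refine exists_solution_Ici_of_apriori_bound (contDiff_fieldPhi hV.contDiff) q
    (fun T => max (|q.1| + B * T) (max |q.2.1| B)) ?_
  intro T t ht γ h0 hγ
  have hB : ∀ r ∈ Icc 0 t, (γ r).2.2.1 ^ 2 + (γ r).2.2.2 ^ 2 ≤ B := fun r hr =>
    sq_add_sq_le hC hVC
      (constraint_eq_one (hV.contDiff.differentiable two_ne_zero) hγ (by rw [h0, hq]) hr)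
      (by simpa [h0] using abs_x_le hγ hr)
  have htt : t ∈ Icc 0 t := right_mem_Icc.2 ht.1
  have h1 := abs_phi_le hB1 hγ hB htt
  have h2 := abs_x_le hγ htt
  have h3 := hB t htt
  rw [h0] at h1 h2
  have h4 : B * t ≤ B * T := mul_le_mul_of_nonneg_left ht.2 (by linarith)
  simp only [Prod.norm_def, Real.norm_eq_abs]
  refine max_le (le_max_of_le_left (by linarith)) (le_max_of_le_right (max_le ?_ (max_le ?_ ?_)))
  · exact le_max_of_le_left h2
  · refine le_max_of_le_right (abs_le_of_sq_le_sq ?_ (by linarith))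
    nlinarith [sq_nonneg (γ t).2.2.2]
  · refine le_max_of_le_right (abs_le_of_sq_le_sq ?_ (by linarith))
    nlinarith [sq_nonneg (γ t).2.2.1]

/-! ### Regularity of the compactified vector field for `|s| < 1`. -/

section Compactifier

variable {f : ℝ → ℝ}

theorem finv_apply (hf : IsCompactifier f) (φ : ℝ) : finv f (f φ) = φ :=
  Function.leftInverse_invFun hf.strictMono.injective φ

theorem apply_finv (hf : IsCompactifier f) {s : ℝ} (hs : s ∈ Ioo (-1 : ℝ) 1) : f (finv f s) = s :=
  Function.invFun_eq (hf.range_eq.symm ▸ hs : s ∈ range f)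

theorem apply_mem_Ioo (hf : IsCompactifier f) (φ : ℝ) : f φ ∈ Ioo (-1 : ℝ) 1 :=
  hf.range_eq ▸ mem_range_self φ

/-- The inverse function theorem supplies a `C¹` local right inverse, and injectivity of `f`
identifies it with `finv`. -/
theorem contDiffAt_finv (hf : IsCompactifier f) {s : ℝ} (hs : s ∈ Ioo (-1 : ℝ) 1) :
    ContDiffAt ℝ 1 (finv f) s := by
  obtain ⟨φ, rfl⟩ : s ∈ range f := hf.range_eq.symm ▸ hs
  have hc : ContDiffAt ℝ 1 f φ := (hf.contDiff.of_le one_le_two).contDiffAt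
  have hd := (hc.differentiableAt one_ne_zero).hasDerivAt
  let e := ContinuousLinearEquiv.unitsEquivAut ℝ (Units.mk0 _ (hf.deriv_pos φ).ne')
  have he : HasFDerivAt f (e : ℝ →L[ℝ] ℝ) φ := by
    refine hd.hasFDerivAt.congr_fderiv ?_
    ext
    simp [e]
  refine (hc.to_localInverse he one_ne_zero).congr_of_eventuallyEq ?_
  have hr := (hc.hasStrictFDerivAt' he one_ne_zero).eventually_right_inverse
  filter_upwards [hr] with y hy
  exact (congrArg (finv f) hy.symm).trans (finv_apply hf _)

variable {V ψ : ℝ → ℝ} {δ : ℝ}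

theorem contDiffAt_comp_finv (hf : IsCompactifier f) {g : ℝ → ℝ} (hg : ContDiff ℝ 1 g) {s : ℝ}
    (hs : s ∈ Ioo (-1 : ℝ) 1) : ContDiffAt ℝ 1 (fun r => g (finv f r)) s :=
  hg.contDiffAt.comp s (contDiffAt_finv hf hs)

theorem contDiffAt_speed (hf : IsCompactifier f) {s : ℝ} (hs : s ∈ Ioo (-1 : ℝ) 1) :
    ContDiffAt ℝ 1 (speed f) s := by
  refine (contDiffAt_comp_finv hf (contDiff_deriv hf.contDiff) hs).congr_of_eventuallyEq ?_
  filter_upwards [Ioo_mem_nhds hs.1 hs.2] with r hr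
  exact if_pos hr

theorem uExt_eq {s : ℝ} (hs : s ∈ Ioo (-1 : ℝ) 1) : uExt V f s = uFun V f s := by
  rw [uExt, if_neg hs.2.ne, if_neg hs.1.ne']

theorem contDiffAt_cutoff (hψ : IsCutoff V f δ ψ) {s : ℝ} (hs : s ∈ Ioo (-1 : ℝ) 1) :
    ContDiffAt ℝ 1 ψ s :=
  (hψ.contDiffOn.contDiffAt (Icc_mem_nhds hs.1 hs.2)).of_le (by exact_mod_cast le_top)

/-- The quotient `u` is singular only at zeros of `V`. These satisfy `|s| < 1 - δ` strictly, so `1 -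
ψ` vanishes on a whole neighbourhood of each. -/
theorem contDiffAt_one_sub_cutoff_mul_uExt (hf : IsCompactifier f)
    (hV : IsAdmissiblePotential V f) (hψ : IsCutoff V f δ ψ) {s : ℝ} (hs : s ∈ Ioo (-1 : ℝ) 1) :
    ContDiffAt ℝ 1 (fun r => (1 - ψ r) * uExt V f r) s := by
  by_cases h0 : V (finv f s) = 0
  · have hlt : |s| < 1 - δ := by
      by_contra h
      exact (hψ.potential_pos s (not_lt.1 h) (abs_lt.2 hs)).ne' h0
    refine (contDiffAt_const (c := (0 : ℝ))).congr_of_eventuallyEq ?_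
    filter_upwards [Ioo_mem_nhds hs.1 hs.2, continuous_abs.continuousAt.eventually_lt_const hlt]
      with r hr hr'
    rw [hψ.eq_one r hr'.le (Ioo_subset_Icc_self hr), sub_self, zero_mul]
  · refine (contDiffAt_const.sub (contDiffAt_cutoff hψ hs)).mul ?_
    have : ContDiffAt ℝ 1 (uFun V f) s := by
      refine (contDiffAt_comp_finv hf (contDiff_deriv hV.contDiff) hs).div
        (contDiffAt_const.mul (contDiffAt_comp_finv hf (hV.contDiff.of_le one_le_two) hs)) ?_
      have : Real.sqrt 6 ≠ 0 := by positivity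
      exact mul_ne_zero this h0
    refine this.congr_of_eventuallyEq ?_
    filter_upwards [Ioo_mem_nhds hs.1 hs.2] with r hr using uExt_eq hr

/-- The vector field is `C¹` where `|s| < 1`. -/
theorem contDiffAt_field (hf : IsCompactifier f) (hV : IsAdmissiblePotential V f)
    (hψ : IsCutoff V f δ ψ) {p : Phase} (hp : p.1 ∈ Ioo (-1 : ℝ) 1) :
    ContDiffAt ℝ 1 (field V f ψ) p := by
  have comp : ∀ {g : ℝ → ℝ}, ContDiffAt ℝ 1 g p.1 → ContDiffAt ℝ 1 (fun q : Phase => g q.1) p :=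
    fun hg => ContDiffAt.comp p hg contDiffAt_fst
  have h1 := comp (contDiffAt_speed hf hp)
  have h2 := comp (contDiffAt_one_sub_cutoff_mul_uExt hf hV hψ hp)
  have h3 := comp (contDiffAt_cutoff hψ hp)
  have h4 := comp (contDiffAt_comp_finv hf (contDiff_deriv hV.contDiff) hp)
  -- The terms are regrouped so that `uExt` occurs only multiplied by `1 - ψ`: the product is `C¹`
  -- even where `uExt` is not.
  have : field V f ψ = fun q : Phase => (speed f q.1 * q.2.2.1,
      -(q.2.1 / Real.sqrt 6) * (3 * q.2.2.1 ^ 2 + q.2.2.2 ^ 2),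
      Real.sqrt (3 / 2) * ((1 - ψ q.1) * (q.2.2.1 * (1 - q.2.2.1 ^ 2 - q.2.2.2 ^ 2 / 3))
        - (1 - ψ q.1) * uExt V f q.1 * (1 - q.2.2.1 ^ 2 - q.2.2.2 ^ 2))
      + ψ q.1 * (Real.sqrt (3 / 2) * q.2.2.1 * (1 - q.2.2.1 ^ 2 - q.2.2.2 ^ 2 / 3)
        - 1 / 2 * deriv V (finv f q.1) * q.2.1 ^ 2),
      q.2.2.2 / Real.sqrt 6 * (1 - 3 * q.2.2.1 ^ 2 - q.2.2.2 ^ 2)) := by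
    funext ⟨s, x, w, z⟩
    simp only [field, theta1, theta2, Prod.mk.injEq, true_and, and_true]
    ring
  rw [this]
  refine (h1.mul (by fun_prop)).prodMk (ContDiffAt.prodMk (by fun_prop) (ContDiffAt.prodMk
    (ContDiffAt.add (contDiffAt_const.mul (ContDiffAt.sub
      (ContDiffAt.mul (contDiffAt_const.sub h3) (by fun_prop)) (h2.mul (by fun_prop))))
      (h3.mul (ContDiffAt.sub (by fun_prop) ((contDiffAt_const.mul h4).mul (by fun_prop)))))
    (by fun_prop)))

/-! ### Solutions in `Ω` lifted from `φ` to `s`, and their uniqueness. -/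

/-- The point with coordinates `(f φ, x, w, z)`. -/
def liftPhi (f : ℝ → ℝ) (q : Phase) : Phase := (f q.1, q.2)

/-- On the constraint set the system in `(s, x, w, z)` is the one in `(φ, x, w, z)`. -/
theorem field_liftPhi (hf : IsCompactifier f) (hψ : IsCutoff V f δ ψ) {q : Phase}
    (hq : constraint V q = 1) :
    field V f ψ (liftPhi f q) = (deriv f q.1 * q.2.2.1, (fieldPhi V q).2) := by
  obtain ⟨φ, x, w, z⟩ := q
  have hs := apply_mem_Ioo hf φ
  have hspeed : speed f (f φ) = deriv f φ := by rw [speed, if_pos hs, finv_apply hf]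
  have h6 : (0 : ℝ) < Real.sqrt 6 := by positivity
  have h66 : Real.sqrt 6 ^ 2 = 6 := Real.sq_sqrt (by norm_num)
  simp only [field, liftPhi, fieldPhi, hspeed, Prod.mk.injEq, true_and, and_true, theta2,
    finv_apply hf]
  -- Either `ψ = 1` and `θ₁` drops out, or `V > 0` and the constraint cancels the `V` in the
  -- denominator of `u`, giving `θ₁ = θ₂`.
  rcases le_or_gt |f φ| (1 - δ) with h | h
  · rw [hψ.eq_one _ h (Ioo_subset_Icc_self hs)]
    ring
  · have hV := hψ.potential_pos _ h.le (abs_lt.2 hs)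
    rw [finv_apply hf] at hV
    have key : Real.sqrt (3 / 2) * (uExt V f (f φ) * (1 - w ^ 2 - z ^ 2))
        = 1 / 2 * deriv V φ * x ^ 2 := by
      have hc : 1 - w ^ 2 - z ^ 2 = V φ * x ^ 2 := by
        simp only [constraint] at hq
        linarith
      rw [uExt_eq hs, uFun, finv_apply hf, sqrt_three_halves, hc]
      field_simp
      rw [h66]
      ring
    have : theta1 V f (f φ) w z = Real.sqrt (3 / 2) * w * (1 - w ^ 2 - z ^ 2 / 3)
        - 1 / 2 * deriv V φ * x ^ 2 := by
      rw [theta1, mul_sub, key]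
      ring
    rw [this]
    ring

theorem mem_omegaSet_iff {xbar : ℝ} {p : Phase} : p ∈ omegaSet V f xbar ↔
    p.1 ∈ Ioo (-1 : ℝ) 1 ∧ p.2.1 ∈ Ioc 0 xbar ∧
      V (finv f p.1) * p.2.1 ^ 2 + p.2.2.1 ^ 2 + p.2.2.2 ^ 2 = 1 := Iff.rfl

theorem omegaSet_subset_closedBall (hV : IsAdmissiblePotential V f) (xbar : ℝ) :
    ∃ R : ℝ, omegaSet V f xbar ⊆ Metric.closedBall 0 R := by
  obtain ⟨C, hC, hVC⟩ := exists_lower_bound hV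
  refine ⟨max 1 (max xbar (1 + C * xbar ^ 2)), fun p hp => ?_⟩
  obtain ⟨hs, hx, hc⟩ := mem_omegaSet_iff.1 hp
  have hxx : |p.2.1| ≤ xbar := by rw [abs_of_pos hx.1]; exact hx.2
  have hB := sq_add_sq_le hC hVC (q := (finv f p.1, p.2)) hc hxx
  have hB0 : 0 ≤ C * xbar ^ 2 := by positivity
  simp only at hB
  rw [mem_closedBall_zero_iff]
  simp only [Prod.norm_def, Real.norm_eq_abs]
  refine max_le (le_max_of_le_left (abs_lt.2 hs).le)
    (le_max_of_le_right (max_le (le_max_of_le_left hxx) (le_max_of_le_right (max_le ?_ ?_))))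
  · refine abs_le_of_sq_le_sq ?_ (by linarith)
    nlinarith [sq_nonneg p.2.2.2]
  · refine abs_le_of_sq_le_sq ?_ (by linarith)
    nlinarith [sq_nonneg p.2.2.1]

/-- Existence of a global solution in `Ω`, along which `z / x` grows exponentially. -/
theorem exists_solution_mem_omegaSet (hf : IsCompactifier f) (hV : IsAdmissiblePotential V f)
    (hψ : IsCutoff V f δ ψ) {xbar : ℝ} {p : Phase} (hp : p ∈ omegaSet V f xbar) :
    ∃ γ : ℝ → Phase, IsSolutionOn V f ψ (Ici 0) γ ∧ γ 0 = p ∧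
      (∀ τ : ℝ, 0 ≤ τ → γ τ ∈ omegaSet V f xbar) ∧
      ∀ τ : ℝ, 0 ≤ τ →
        (γ τ).2.2.2 * Real.exp (-τ / Real.sqrt 6) / (γ τ).2.1 = p.2.2.2 / p.2.1 := by
  obtain ⟨hs, hx, hc⟩ := mem_omegaSet_iff.1 hp
  obtain ⟨C, hC, hVC⟩ := exists_lower_bound hV
  obtain ⟨γ, h0, hγ⟩ := exists_global_solution_fieldPhi hV (finv f p.1, p.2) hc
  have hγT : ∀ T, ∀ t ∈ Icc 0 T, HasDerivWithinAt γ (fieldPhi V (γ t)) (Icc 0 T) t :=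
    fun T t ht => (hγ t ht.1).mono Icc_subset_Ici_self
  have hcon : ∀ t, 0 ≤ t → constraint V (γ t) = 1 := fun t ht =>
    constraint_eq_one (hV.contDiff.differentiable two_ne_zero) (hγT t) (by rw [h0]; exact hc)
      (right_mem_Icc.2 ht)
  have hxle : ∀ t, 0 ≤ t → |(γ t).2.1| ≤ p.2.1 := fun t ht => by
    have := abs_x_le (hγT t) (right_mem_Icc.2 ht)
    rwa [h0, abs_of_pos (a := p.2.1) hx.1] at this
  have hxpos : ∀ t, 0 ≤ t → 0 < (γ t).2.1 := fun t ht =>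
    x_pos (hγT t) (fun r hr => sq_add_sq_le hC hVC (hcon r hr.1) (hxle r hr.1))
      (by rw [h0]; exact hx.1) (right_mem_Icc.2 ht)
  refine ⟨fun t => liftPhi f (γ t), fun t ht => ⟨?_, ?_⟩, ?_, fun t ht => ?_, fun t ht => ?_⟩
  · exact Ioo_subset_Icc_self (apply_mem_Ioo hf _)
  · rw [field_liftPhi hf hψ (hcon t ht)]
    obtain ⟨h1, h234⟩ := hasDerivWithinAt_phase_iff.1 (hγ t ht)
    refine hasDerivWithinAt_phase_iff.2 ⟨?_, h234⟩
    exact ((hf.contDiff.differentiable two_ne_zero) (γ t).1).hasDerivAt.comp_hasDerivWithinAt t h1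
  · simp only [h0, liftPhi, apply_finv hf hs]
  · refine mem_omegaSet_iff.2 ⟨apply_mem_Ioo hf _, ⟨hxpos t ht, ?_⟩, ?_⟩
    · exact (le_abs_self _).trans ((hxle t ht).trans hx.2)
    · simp only [liftPhi, finv_apply hf]
      exact hcon t ht
  · have := z_mul_exp_div_x (hγT t) (fun r hr => hxpos r hr.1) (right_mem_Icc.2 ht)
    rwa [h0] at this

/-- Uniqueness among all solutions in `s ∈ [-1, 1]`. -/
theorem eqOn_of_isSolutionOn (hf : IsCompactifier f) (hV : IsAdmissiblePotential V f)
    (hψ : IsCutoff V f δ ψ) {γ η : ℝ → Phase} {J : Set ℝ} (hJ : J.OrdConnected) (h0J : 0 ∈ J)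
    (hJ0 : J ⊆ Ici 0) (hγ : IsSolutionOn V f ψ (Ici 0) γ)
    (hs : ∀ τ : ℝ, 0 ≤ τ → (γ τ).1 ∈ Ioo (-1 : ℝ) 1)
    (hη : IsSolutionOn V f ψ J η) (h0 : η 0 = γ 0) : EqOn η γ J := by
  intro T hT
  have hsub : Icc 0 T ⊆ J := hJ.out h0J hT
  -- Lipschitz bounds are needed only along `γ`, which keeps `|s| < 1`; the competitor `η` may a
  -- priori touch `s = ±1`.
  refine (eqOn_Icc_of_locally_lipschitz (F := field V f ψ) ?_ ?_ ?_ h0.symm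
    (right_mem_Icc.2 (hJ0 hT))).symm
  · exact fun t ht => (contDiffAt_field hf hV hψ (hs t ht.1)).exists_lipschitzOnWith
  · exact fun t ht => (hγ t ht.1).2.mono Icc_subset_Ici_self
  · exact fun t ht => (hη t (hsub ht)).2.mono hsub

/-! ### Convergence to the limit set and density of the generic data. -/

/-- Points of the closure of `Ω` with `x = 0` belong to the limit set. -/
theorem mem_limitSet_of_mem_closure (hf : IsCompactifier f) (hV : IsAdmissiblePotential V f)
    {xbar : ℝ} {p : Phase} (hp : p ∈ closure (omegaSet V f xbar)) (hx : p.2.1 = 0) :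
    p ∈ limitSet V f xbar := by
  refine ⟨⟨hp, ?_⟩, hx⟩
  have hs : p.1 ∈ Icc (-1 : ℝ) 1 := by
    have hcl : IsClosed {q : Phase | q.1 ∈ Icc (-1 : ℝ) 1} := isClosed_Icc.preimage continuous_fst
    refine closure_minimal (t := {q : Phase | q.1 ∈ Icc (-1 : ℝ) 1}) (fun q hq => ?_) hcl hp
    exact Ioo_subset_Icc_self (mem_omegaSet_iff.1 hq).1
  by_cases h1 : |p.1| = 1
  · exact Or.inl h1
  refine Or.inr ?_
  have hs' : p.1 ∈ Ioo (-1 : ℝ) 1 := abs_lt.1 (lt_of_le_of_ne (abs_le.2 hs) h1)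
  -- Away from `|s| = 1` the constraint function is continuous, so its value `1` passes to the
  -- closure; with `x = 0` it reads `w² + z² = 1`.
  have hc : ContinuousAt
      (fun q : Phase => V (finv f q.1) * q.2.1 ^ 2 + q.2.2.1 ^ 2 + q.2.2.2 ^ 2) p := by
    have : ContinuousAt (fun q : Phase => V (finv f q.1)) p :=
      ContinuousAt.comp (f := Prod.fst) (g := fun s => V (finv f s))
        (contDiffAt_comp_finv hf (hV.contDiff.of_le one_le_two) hs').continuousAt continuousAt_fst
    exact ((this.mul (by fun_prop)).add (by fun_prop)).add (by fun_prop)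
  have : NeBot (𝓝[omegaSet V f xbar] p) := mem_closure_iff_nhdsWithin_neBot.1 hp
  have hlim : Tendsto (fun q : Phase => V (finv f q.1) * q.2.1 ^ 2 + q.2.2.1 ^ 2 + q.2.2.2 ^ 2)
      (𝓝[omegaSet V f xbar] p) (𝓝 1) :=
    tendsto_const_nhds.congr' (eventually_mem_nhdsWithin.mono fun q hq =>
      (mem_omegaSet_iff.1 hq).2.2.symm)
  have := tendsto_nhds_unique (hc.tendsto.mono_left nhdsWithin_le_nhds) hlim
  simpa [hx] using this

/-- A curve in `Ω` along which `x` tends to zero approaches the limit set. -/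
theorem approaches_limitSet (hf : IsCompactifier f) (hV : IsAdmissiblePotential V f)
    {xbar : ℝ} {γ : ℝ → Phase} (hγ : ∀ τ : ℝ, 0 ≤ τ → γ τ ∈ omegaSet V f xbar)
    (hx : Tendsto (fun τ => (γ τ).2.1) atTop (𝓝 0)) : Approaches γ (limitSet V f xbar) := by
  obtain ⟨R, hR⟩ := omegaSet_subset_closedBall hV xbar
  have hK : IsCompact (closure (omegaSet V f xbar)) :=
    (isCompact_closedBall (0 : Phase) R).of_isClosed_subset isClosed_closure
      (closure_minimal hR Metric.isClosed_closedBall)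
  refine (ENNReal.tendsto_nhds_zero).2 fun ε hε => ?_
  -- On this compact set of points at distance at least `ε`, `|x|` is bounded below by a positive
  -- minimum, so a curve with `x → 0` must leave it.
  have hA : IsCompact (closure (omegaSet V f xbar) ∩
      {p | ε ≤ Metric.infEDist p (limitSet V f xbar)}) :=
    hK.inter_right (isClosed_le continuous_const Metric.continuous_infEDist)
  rcases eq_empty_or_nonempty (closure (omegaSet V f xbar) ∩
      {p | ε ≤ Metric.infEDist p (limitSet V f xbar)}) with he | hne
  · filter_upwards [eventually_ge_atTop 0] with τ hτ
    by_contra h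
    have : γ τ ∈ (∅ : Set Phase) := he ▸ ⟨subset_closure (hγ τ hτ), (not_le.1 h).le⟩
    exact this
  · obtain ⟨m, hm, hmin⟩ := hA.exists_isMinOn hne
      (f := fun p : Phase => |p.2.1|) (by fun_prop)
    have hpos : 0 < |m.2.1| := by
      refine abs_pos.2 fun h0 => ?_
      have h1 := hm.2
      have h2 := Metric.infEDist_zero_of_mem (mem_limitSet_of_mem_closure hf hV hm.1 h0)
      rw [mem_ofPred_eq, h2] at h1
      exact absurd hε (not_lt.2 h1)
    have hx' := hx.abs
    rw [abs_zero] at hx'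
    filter_upwards [eventually_ge_atTop 0, hx'.eventually_lt_const hpos] with τ hτ hlt
    by_contra h
    exact absurd (hmin ⟨subset_closure (hγ τ hτ), (not_le.1 h).le⟩) (not_le.2 hlt)

/-- The data with `z ≠ 0` are dense in `Ω`. -/
theorem omegaSet_subset_closure_z_ne_zero (xbar : ℝ) : omegaSet V f xbar ⊆
    closure ({p | p.2.2.2 ≠ 0} ∩ omegaSet V f xbar) := by
  rintro ⟨s, x, w, z⟩ hp
  obtain ⟨hs, hx, hc⟩ := mem_omegaSet_iff.1 hp
  simp only at hs hx hc
  by_cases hz : z = 0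
  swap
  · exact subset_closure ⟨hz, hp⟩
  subst hz
  have hev : ∀ᶠ ε : ℝ in 𝓝[>] 0, 0 < ε := eventually_mem_nhdsWithin
  have hlt : ∀ a : ℝ, 0 < a → ∀ᶠ ε : ℝ in 𝓝[>] 0, ε < a := fun a ha =>
    eventually_nhdsWithin_of_eventually_nhds (eventually_lt_nhds ha)
  -- Room for `z = ε` is taken from `w` if possible. If `w = 0` then `V x² = 1`, and shrinking `x`
  -- frees it while keeping `x ≤ xbar`; for `w ≠ 0` the sign of `V` is unknown.
  by_cases hw : w = 0
  · subst hw
    have ht : Tendsto (fun ε : ℝ => ((s, x * Real.sqrt (1 - ε ^ 2), 0, ε) : Phase)) (𝓝[>] 0)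
        (𝓝 (s, x, 0, 0)) := by
      have : Continuous fun ε : ℝ => ((s, x * Real.sqrt (1 - ε ^ 2), 0, ε) : Phase) := by fun_prop
      simpa using (this.tendsto 0).mono_left nhdsWithin_le_nhds
    refine mem_closure_of_tendsto ht ?_
    filter_upwards [hev, hlt 1 one_pos] with ε h0 h1
    have h2 : 0 < 1 - ε ^ 2 := by nlinarith
    have h3 : Real.sqrt (1 - ε ^ 2) ≤ 1 := Real.sqrt_le_one.2 (by nlinarith)
    refine ⟨h0.ne', mem_omegaSet_iff.2 ⟨hs, ⟨mul_pos hx.1 (Real.sqrt_pos.2 h2), ?_⟩, ?_⟩⟩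
    · exact (mul_le_of_le_one_right hx.1.le h3).trans hx.2
    · simp only [mul_pow, Real.sq_sqrt h2.le]
      linear_combination (1 - ε ^ 2) * hc
  · have ht : Tendsto (fun ε : ℝ => ((s, x, w * Real.sqrt (1 - ε ^ 2 / w ^ 2), ε) : Phase))
        (𝓝[>] 0) (𝓝 (s, x, w, 0)) := by
      have : Continuous fun ε : ℝ => ((s, x, w * Real.sqrt (1 - ε ^ 2 / w ^ 2), ε) : Phase) := by
        fun_prop
      simpa using (this.tendsto 0).mono_left nhdsWithin_le_nhds
    refine mem_closure_of_tendsto ht ?_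
    filter_upwards [hev, hlt |w| (abs_pos.2 hw)] with ε h0 h1
    have hw2 : 0 < w ^ 2 := by positivity
    have h2 : 0 ≤ 1 - ε ^ 2 / w ^ 2 := by
      rw [sub_nonneg, div_le_one hw2, ← sq_abs w]
      exact pow_le_pow_left₀ h0.le h1.le 2
    refine ⟨h0.ne', mem_omegaSet_iff.2 ⟨hs, hx, ?_⟩⟩
    simp only [mul_pow, Real.sq_sqrt h2]
    field_simp
    linear_combination hc

/-- If `z / x` grows exponentially along a curve in `Ω`, then `x` tends to zero. -/
theorem tendsto_x_zero (hV : IsAdmissiblePotential V f) {xbar : ℝ} {γ : ℝ → Phase} {k : ℝ}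
    (hγ : ∀ τ : ℝ, 0 ≤ τ → γ τ ∈ omegaSet V f xbar) (hk : k ≠ 0)
    (hratio : ∀ τ : ℝ, 0 ≤ τ →
      (γ τ).2.2.2 * Real.exp (-τ / Real.sqrt 6) / (γ τ).2.1 = k) :
    Tendsto (fun τ => (γ τ).2.1) atTop (𝓝 0) := by
  obtain ⟨R, hR⟩ := omegaSet_subset_closedBall hV xbar
  have h6 : (0 : ℝ) < Real.sqrt 6 := by positivity
  have hexp : Tendsto (fun τ : ℝ => R / |k| * Real.exp (-τ / Real.sqrt 6)) atTop (𝓝 0) := by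
    have : Tendsto (fun τ : ℝ => -τ / Real.sqrt 6) atTop atBot :=
      tendsto_neg_atTop_atBot.atBot_div_const h6
    simpa using (Real.tendsto_exp_atBot.comp this).const_mul (R / |k|)
  refine squeeze_zero_norm' ?_ hexp
  filter_upwards [eventually_ge_atTop 0] with τ hτ
  have hx := (mem_omegaSet_iff.1 (hγ τ hτ)).2.1.1
  have hz : |(γ τ).2.2.2| ≤ R := by
    have h := mem_closedBall_zero_iff.1 (hR (hγ τ hτ))
    exact ((norm_snd_le _).trans ((norm_snd_le _).trans (norm_snd_le _))).trans h
  have hk' : 0 < |k| := abs_pos.2 hk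
  -- Solving the ratio identity for `x` turns the bound on `z` into exponential decay of `x`.
  have he : (γ τ).2.1 * |k| = |(γ τ).2.2.2| * Real.exp (-τ / Real.sqrt 6) := by
    rw [← hratio τ hτ, abs_div, abs_mul, abs_of_pos (Real.exp_pos _), abs_of_pos hx]
    field_simp
  rw [Real.norm_eq_abs, abs_of_pos hx, div_mul_eq_mul_div, le_div_iff₀ hk', he]
  exact mul_le_mul_of_nonneg_right hz (Real.exp_pos _).le

end Compactifier

end ScalarCollapse

end

theorem mainTheorem2 (f V ψ : ℝ → ℝ) (δ xbar : ℝ)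
    (hf : ScalarCollapse.IsCompactifier f)
    (hV : ScalarCollapse.IsAdmissiblePotential V f)
    (hψ : ScalarCollapse.IsCutoff V f δ ψ)
    (hx : 0 < xbar) :
    -- every datum in `Ω` has a global solution, it is unique, and it remains in `Ω`
    (∀ p ∈ ScalarCollapse.omegaSet V f xbar, ∃ γ : ℝ → ScalarCollapse.Phase,
      ScalarCollapse.IsSolutionOn V f ψ (Ici 0) γ ∧ γ 0 = p ∧
      (∀ τ : ℝ, 0 ≤ τ → γ τ ∈ ScalarCollapse.omegaSet V f xbar) ∧
      (∀ (J : Set ℝ) (η : ℝ → ScalarCollapse.Phase), J.OrdConnected → 0 ∈ J → J ⊆ Ici 0 →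
        ScalarCollapse.IsSolutionOn V f ψ J η → η 0 = p → EqOn η γ J)) ∧
    -- `M₋₁` lies in the part of the closure of `Ω` outside `Ω`
    ScalarCollapse.limitSet V f xbar ⊆
      closure (ScalarCollapse.omegaSet V f xbar) \ ScalarCollapse.omegaSet V f xbar ∧
    -- generically the solution approaches `M₋₁`, and `x` tends to `0` from above
    ScalarCollapse.HoldsGenericallyOn (ScalarCollapse.omegaSet V f xbar) (fun p =>
      ∀ γ : ℝ → ScalarCollapse.Phase,
        ScalarCollapse.IsSolutionOn V f ψ (Ici 0) γ → γ 0 = p →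
          ScalarCollapse.Approaches γ (ScalarCollapse.limitSet V f xbar) ∧
          Tendsto (fun τ => (γ τ).2.1) atTop (𝓝[>] 0)) := by
  open ScalarCollapse in
  refine ⟨fun p hp => ?_, fun p hp => ⟨hp.1.1, fun h => ?_⟩, {p | p.2.2.2 ≠ 0}, ?_,
    omegaSet_subset_closure_z_ne_zero xbar, ?_⟩
  · obtain ⟨γ, hγ, h0, hin, -⟩ := exists_solution_mem_omegaSet hf hV hψ hp
    exact ⟨γ, hγ, h0, hin, fun J η hJ h0J hJ0 hη hη0 =>
      eqOn_of_isSolutionOn hf hV hψ hJ h0J hJ0 hγ (fun τ hτ => (mem_omegaSet_iff.1 (hin τ hτ)).1)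
        hη (hη0.trans h0.symm)⟩
  · exact (mem_omegaSet_iff.1 h).2.1.1.ne' hp.2
  · exact isOpen_ne_fun (by fun_prop) continuous_const
  · rintro p ⟨hz, hp⟩ η hη hη0
    obtain ⟨γ, hγ, h0, hin, hratio⟩ := exists_solution_mem_omegaSet hf hV hψ hp
    -- The generic claim concerns every solution from `p`; uniqueness hands `η` the ratio identity
    -- known for `γ`.
    have heq : EqOn η γ (Ici 0) := eqOn_of_isSolutionOn hf hV hψ ordConnected_Ici self_mem_Ici
      subset_rfl hγ (fun τ hτ => (mem_omegaSet_iff.1 (hin τ hτ)).1) hη (hη0.trans h0.symm)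
    have hinη : ∀ τ : ℝ, 0 ≤ τ → η τ ∈ omegaSet V f xbar := fun τ hτ => heq hτ ▸ hin τ hτ
    have hx0 := tendsto_x_zero hV hinη
      (div_ne_zero hz (mem_omegaSet_iff.1 hp).2.1.1.ne') fun τ hτ => by
        rw [heq hτ]
        exact hratio τ hτ
    refine ⟨approaches_limitSet hf hV hinη hx0, tendsto_nhdsWithin_iff.2 ⟨hx0, ?_⟩⟩
    filter_upwards [eventually_ge_atTop 0] with τ hτ
    exact (mem_omegaSet_iff.1 (hinη τ hτ)).2.1.1
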